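/- Consider the random-to-random transposition shuffle of a deck of $n$ cards: at every step two locations $L_t,R_t$ are chosen independently and uniformly from the $n$ locations (independently of the past), and the cards at these two locations are switched. For a set $C$ of cards let $$d_C(t)=\max_{\sigma_0}\|\mu_C^{\sigma_t}-\mu_C^{\pi}\|_{\mathrm{TV}},$$ where $\mu_C^{\sigma_t}$ is the joint law of the locations of the cards of $C$ after $t$ steps started from the deck $\sigma_0$, and $\mu_C^{\pi}$ is their joint law in a uniformly random deck. For $k=k(n)$ put $D_n(t)=\max_{|C|=k}d_C(t)$, where for real $t$ the deck at time $t$ is the deck after $\lfloor t\rfloor$ steps (the initial deck if $t<0$). The shuffle has $k$-partial cutoff at time $t_{\mathrm{mix}}=t_{\mathrm{mix}}(n)$ with a window of size $\omega=\omega(n)=o(t_{\mathrm{mix}})$ if $$\lim_{\alpha\to\infty}\limsup_{n\to\infty}D_n(t_{\mathrm{mix}}+\alpha\omega)=0\quad\text{and}\quad\lim_{\alpha\to-\infty}\liminf_{n\to\infty}D_n(t_{\mathrm{mix}}+\alpha\omega)=1.$$ (1) If $k=o((n/\log n)^{1/2})$ and $k\to\infty$ as $n\to\infty$, then the random-to-random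 transposition shuffle has $k$-partial cutoff at time $\tfrac12 n\log k$ with a window of size $\omega(n)=n$ (in particular, of size $O(n)$). (2) If there is a constant $K$ with $k(n)<K$ for all $n$, then there is no cutoff: there are no $t_{\mathrm{mix}}$ and $\omega=o(t_{\mathrm{mix}})$ for which the shuffle has $k$-partial cutoff at time $t_{\mathrm{mix}}$ with a window of size $\omega$. (3) For every $n\ge1$, every single card $i$ and every integer $t\ge0$, $d_{\{i\}}(t)\le e^{-2t(1-2/n)/n}$. -/

import Mathlib

open Filter Topology Asymptotics

noncomputable section

namespace CardShuffle

/-- Total variation distance between two probability distributions on a finite set. -/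
def tvDist {α : Type*} [Fintype α] (μ ν : PMF α) : ℝ :=
  (1 / 2) * ∑ a, |(μ a).toReal - (ν a).toReal|

/-- One step of a semi-random transposition shuffle. A deck is a permutation `σ` with `σ j` the
card at location `j`. The left hand picks a location with law `ℓ`, the right hand independently
picks a uniform location, and the cards at these two locations switch places. -/
def step {n : ℕ} [NeZero n] (ℓ : PMF (Fin n)) (σ : Equiv.Perm (Fin n)) :
    PMF (Equiv.Perm (Fin n)) :=
  ℓ.bind fun l => (PMF.uniformOfFintype (Fin n)).map fun r => σ * Equiv.swap l r

/-- The law of the deck at time `t`, started from `σ₀`, when at every time `s` the left hand picks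
a location with law `ℓ s`, independently of everything else. -/
def deckLaw {n : ℕ} [NeZero n] (ℓ : ℕ → PMF (Fin n)) (σ₀ : Equiv.Perm (Fin n)) :
    ℕ → PMF (Equiv.Perm (Fin n))
  | 0 => PMF.pure σ₀
  | t + 1 => (deckLaw ℓ σ₀ t).bind (step (ℓ (t + 1)))

/-- The joint law of the locations of the cards in `C`, for a random deck with law `μ`. -/
def locationLaw {n : ℕ} (C : Finset (Fin n)) (μ : PMF (Equiv.Perm (Fin n))) : PMF (C → Fin n) :=
  μ.map fun σ c => σ⁻¹ (c : Fin n)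

/-- `d_C(t)`: the distance at time `t` between the joint law of the locations of the cards in `C`
and their joint law in a uniform permutation, maximised over the initial deck. -/
def cardDist {n : ℕ} [NeZero n] (ℓ : ℕ → PMF (Fin n)) (C : Finset (Fin n)) (t : ℕ) : ℝ :=
  ⨆ σ₀ : Equiv.Perm (Fin n),
    tvDist (locationLaw C (deckLaw ℓ σ₀ t))
      (locationLaw C (PMF.uniformOfFintype (Equiv.Perm (Fin n))))

/-- The maximum of `d_C(t)` over all sets `C` of `k` cards. -/
def partialDist {n : ℕ} [NeZero n] (ℓ : ℕ → PMF (Fin n)) (k t : ℕ) : ℝ :=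
  ⨆ C : {C : Finset (Fin n) // C.card = k}, cardDist ℓ C.1 t

/-- A semi-random transposition shuffle, for every nonempty deck: the law of the left hand's choice
as a function of the deck size and of time. -/
abbrev Shuffle : Type := (n : ℕ) → [NeZero n] → ℕ → PMF (Fin n)

/-- The random-to-random transposition shuffle: the left hand is uniform as well. -/
def randomToRandom : Shuffle := fun n _ _ => PMF.uniformOfFintype (Fin n)

/-- `partialDist` for the deck of size `n`, at a real time `s`: the deck at time `s` is the deck
after `⌊s⌋` steps, and the initial deck if `s < 0`. The value for the empty deck is immaterial. -/
def distAt (S : Shuffle) (n k : ℕ) (s : ℝ) : ℝ :=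
  if h : n = 0 then 0
  else
    haveI : NeZero n := ⟨h⟩
    partialDist (S n) k ⌊s⌋₊

/-- `k`-partial cutoff at time `tmix` with a window of size `ω`. -/
structure HasPartialCutoff (S : Shuffle) (k : ℕ → ℕ) (tmix ω : ℕ → ℝ) : Prop where
  window : ω =o[atTop] tmix
  after : Tendsto
    (fun α : ℝ => limsup (fun n : ℕ => distAt S n (k n) (tmix n + α * ω n)) atTop) atTop (𝓝 0)
  before : Tendsto
    (fun α : ℝ => liminf (fun n : ℕ => distAt S n (k n) (tmix n + α * ω n)) atTop) atBot (𝓝 1)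

end CardShuffle

end

noncomputable section

namespace CardShuffle

/-! Everything follows from two bounds on `partialDist` at a fixed deck size, with the law of the
shuffle replaced by iterates of the averaging operator `avgStep` acting on test functions.

Upper bound: two decks can be made to agree on the locations of the `k` cards of `C` by a
rearrangement `ρ` moving at most `2k` locations. Uniform transpositions are conjugation invariant,
so the shuffle from `σ * ρ` can be coupled with the one from `σ` as `τ * ρ` against `τ`. The two
differ on `C` only if `τ` puts a card of `C` in the support of `ρ`. A fixed location holds such a
card with probability at most `(1 - 2/n)^t + k/n`, and a union bound gives `partialDist_le`. At time
`½ n log k + αn` this is of order `e^(-2α) + k²/n`.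

Lower bound: from the identity deck, an untouched card is still at its own label, an event of
probability at most `k/n` in a uniform deck for `k` cards together. A second moment estimate for the
number of untouched cards, of mean `k (1 - 1/n)^(2t)`, gives `one_sub_le_partialDist`.

For bounded `k` both bounds decay on the scale `n`: a small distance forces times beyond a large
multiple of `n`, and since the window is negligible, times at which the distance should be near 1
are then also large multiples of `n`, where it is small. -/

/-- The expectation of `f` under a distribution on a finite set. -/
def expect {α : Type*} [Fintype α] (μ : PMF α) (f : α → ℝ) : ℝ := ∑ a, (μ a).toReal * f a

/-! ### Expectations and total variation distance. -/

section expect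

variable {α β : Type*} [Fintype α] [Fintype β]

theorem sum_toReal (μ : PMF α) : ∑ a, (μ a).toReal = 1 := by
  rw [← ENNReal.toReal_sum fun a _ => μ.apply_ne_top a, ← tsum_fintype (L := .unconditional α),
    μ.tsum_coe, ENNReal.toReal_one]

theorem expect_sub (μ : PMF α) (f g : α → ℝ) :
    expect μ (fun a => f a - g a) = expect μ f - expect μ g := by
  simp [expect, mul_sub]

theorem expect_const (μ : PMF α) (c : ℝ) : expect μ (fun _ => c) = c := by
  simp [expect, ← Finset.sum_mul, sum_toReal]

theorem expect_pure (a : α) (f : α → ℝ) : expect (PMF.pure a) f = f a := by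
  classical
  rw [expect, Finset.sum_eq_single a] <;> simp +contextual [PMF.pure_apply]

theorem expect_bind (μ : PMF α) (κ : α → PMF β) (f : β → ℝ) :
    expect (μ.bind κ) f = expect μ fun a => expect (κ a) f := by
  have h : ∀ b, ((μ.bind κ) b).toReal = ∑ a, (μ a).toReal * (κ a b).toReal := fun b => by
    rw [PMF.bind_apply, tsum_fintype, ENNReal.toReal_sum]
    · simp
    · exact fun a _ => ENNReal.mul_ne_top (μ.apply_ne_top a) ((κ a).apply_ne_top b)
  simp only [expect, h, Finset.sum_mul, Finset.mul_sum]
  rw [Finset.sum_comm]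
  simp only [mul_assoc]

theorem expect_map (μ : PMF α) (g : α → β) (f : β → ℝ) :
    expect (μ.map g) f = expect μ fun a => f (g a) := by
  rw [PMF.map, expect_bind]
  simp [expect_pure]

theorem expect_uniform [Nonempty α] (f : α → ℝ) :
    expect (PMF.uniformOfFintype α) f = (∑ a, f a) / Fintype.card α := by
  simp [expect, PMF.uniformOfFintype_apply, ← Finset.mul_sum, div_eq_inv_mul]

/-- Duality bound for the total variation distance. -/
theorem tvDist_le {μ ν : PMF α} {B : ℝ}
    (h : ∀ g : α → ℝ, (∀ a, |g a| ≤ 1) → expect μ g - expect ν g ≤ 2 * B) : tvDist μ ν ≤ B := by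
  have := h (fun a => if 0 ≤ (μ a).toReal - (ν a).toReal then 1 else -1)
    (fun a => by split_ifs <;> simp)
  have e : tvDist μ ν = (1 / 2) * (expect μ (fun a => if 0 ≤ (μ a).toReal - (ν a).toReal
      then 1 else -1) - expect ν (fun a => if 0 ≤ (μ a).toReal - (ν a).toReal then 1 else -1)) := by
    rw [tvDist, expect, expect, ← Finset.sum_sub_distrib]
    congr 1
    refine Finset.sum_congr rfl fun a _ => ?_
    split_ifs with h0
    · rw [abs_of_nonneg h0]; ring
    · rw [abs_of_neg (not_le.1 h0)]; ring
  linarith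

theorem tvDist_nonneg (μ ν : PMF α) : 0 ≤ tvDist μ ν := by
  unfold tvDist; positivity

theorem expect_le {μ : PMF α} {f : α → ℝ} {c : ℝ} (h : ∀ a, f a ≤ c) : expect μ f ≤ c := by
  rw [← expect_const μ c]
  exact Finset.sum_le_sum fun a _ => mul_le_mul_of_nonneg_left (h a) ENNReal.toReal_nonneg

theorem le_expect {μ : PMF α} {f : α → ℝ} {c : ℝ} (h : ∀ a, c ≤ f a) : c ≤ expect μ f := by
  rw [← expect_const μ c]
  exact Finset.sum_le_sum fun a _ => mul_le_mul_of_nonneg_left (h a) ENNReal.toReal_nonneg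

theorem tvDist_le_one (μ ν : PMF α) : tvDist μ ν ≤ 1 :=
  tvDist_le fun g hg => by
    have h1 : expect μ g ≤ 1 := expect_le fun a => (abs_le.1 (hg a)).2
    have h2 : -1 ≤ expect ν g := le_expect fun a => (abs_le.1 (hg a)).1
    linarith

/-- Both laws have mass one, so `f` may be centred at `1/2`; then `|f - 1/2| ≤ 1/2` supplies the
factor in `tvDist`. -/
theorem expect_sub_le_tvDist (μ ν : PMF α) {f : α → ℝ} (h0 : ∀ a, 0 ≤ f a) (h1 : ∀ a, f a ≤ 1) :
    expect μ f - expect ν f ≤ tvDist μ ν := by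
  have e : expect μ f - expect ν f
      = ∑ a, ((μ a).toReal - (ν a).toReal) * (f a - 1 / 2) := by
    have hμ := sum_toReal μ
    have hν := sum_toReal ν
    simp only [expect, sub_mul, mul_sub, Finset.sum_sub_distrib, ← Finset.sum_mul, hμ, hν]
    ring
  rw [e, tvDist, Finset.mul_sum]
  refine Finset.sum_le_sum fun a _ => (le_abs_self _).trans ?_
  rw [abs_mul, mul_comm]
  refine mul_le_mul_of_nonneg_right ?_ (abs_nonneg _)
  rw [abs_le]
  constructor <;> linarith [h0 a, h1 a]

end expect

/-! ### The averaging operator: invariance, stationarity, one-location functions. -/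

/-- The transition operator of the random-to-random transposition shuffle. -/
def avgStep {n : ℕ} (f : Equiv.Perm (Fin n) → ℝ) (σ : Equiv.Perm (Fin n)) : ℝ :=
  (∑ l, ∑ r, f (σ * Equiv.swap l r)) / (n : ℝ) ^ 2

section avgStep

variable {n : ℕ}

theorem expect_deckLaw [NeZero n] (f : Equiv.Perm (Fin n) → ℝ) (σ : Equiv.Perm (Fin n)) (t : ℕ) :
    expect (deckLaw (randomToRandom n) σ t) f = avgStep^[t] f σ := by
  induction t generalizing f with
  | zero => simp [deckLaw, expect_pure]
  | succ t ih =>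
    rw [deckLaw, expect_bind, Function.iterate_succ_apply, ← ih]
    congr 1
    funext τ
    simp only [step, randomToRandom, expect_bind, expect_map, expect_uniform, avgStep,
      Fintype.card_fin, ← Finset.sum_div]
    rw [div_div, sq]

theorem avgStep_mono [NeZero n] {f g : Equiv.Perm (Fin n) → ℝ} (h : ∀ σ, f σ ≤ g σ)
    (σ : Equiv.Perm (Fin n)) (t : ℕ) : avgStep^[t] f σ ≤ avgStep^[t] g σ := by
  rw [← expect_deckLaw, ← expect_deckLaw]
  exact Finset.sum_le_sum fun a _ => mul_le_mul_of_nonneg_left (h a) ENNReal.toReal_nonneg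

theorem avgStep_sum_mul [NeZero n] {ι : Type*} (s : Finset ι) (c : ℝ)
    (f : ι → Equiv.Perm (Fin n) → ℝ) (σ : Equiv.Perm (Fin n)) (t : ℕ) :
    avgStep^[t] (fun τ => c * ∑ i ∈ s, f i τ) σ = c * ∑ i ∈ s, avgStep^[t] (f i) σ := by
  simp only [← expect_deckLaw, expect, Finset.mul_sum]
  rw [Finset.sum_comm]
  exact Finset.sum_congr rfl fun _ _ => Finset.sum_congr rfl fun _ _ => by ring

/-- The increments of the shuffle are invariant under conjugation. -/
theorem avgStep_mul_right (f : Equiv.Perm (Fin n) → ℝ) (σ ρ : Equiv.Perm (Fin n)) (t : ℕ) :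
    avgStep^[t] f (σ * ρ) = avgStep^[t] (fun τ => f (τ * ρ)) σ := by
  have h1 : ∀ (f : Equiv.Perm (Fin n) → ℝ) σ,
      avgStep f (σ * ρ) = avgStep (fun τ => f (τ * ρ)) σ := fun f σ => by
    unfold avgStep
    congr 1
    symm
    rw [← Equiv.sum_comp ρ]
    refine Finset.sum_congr rfl fun l _ => ?_
    rw [← Equiv.sum_comp ρ]
    refine Finset.sum_congr rfl fun r _ => ?_
    change f (σ * Equiv.swap (ρ l) (ρ r) * ρ) = f (σ * ρ * Equiv.swap l r)
    rw [mul_assoc, mul_assoc, Equiv.mul_swap_eq_swap_mul]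
  induction t generalizing f σ with
  | zero => rfl
  | succ t ih =>
    rw [Function.iterate_succ_apply, ih, Function.iterate_succ_apply]
    exact congrArg (fun g => avgStep^[t] g σ) (funext (h1 f))

/-- Stationarity of the uniform deck: right multiplication by a fixed transposition permutes all
decks. -/
theorem sum_avgStep [NeZero n] (f : Equiv.Perm (Fin n) → ℝ) (t : ℕ) :
    ∑ σ, avgStep^[t] f σ = ∑ σ, f σ := by
  induction t with
  | zero => rfl
  | succ t ih =>
    rw [Function.iterate_succ_apply', ← ih]
    generalize avgStep^[t] f = g
    have hn : (n : ℝ) ≠ 0 := Nat.cast_ne_zero.2 (NeZero.ne n)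
    simp only [avgStep, ← Finset.sum_div]
    rw [Finset.sum_comm, div_eq_iff (pow_ne_zero 2 hn)]
    have : ∀ l : Fin n, ∑ σ : Equiv.Perm (Fin n), ∑ r, g (σ * Equiv.swap l r)
        = n * ∑ σ, g σ := fun l => by
      rw [Finset.sum_comm]
      have : ∀ r, ∑ σ, g (σ * Equiv.swap l r) = ∑ σ, g σ := fun r =>
        Equiv.sum_comp (Equiv.mulRight (Equiv.swap l r)) g
      simp [this]
    simp only [this]
    simp
    ring

/-- Averaging a function of one location over all transpositions. -/
theorem sum_swap_apply (h : Fin n → ℝ) (u : Fin n) :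
    ∑ l, ∑ r, h (Equiv.swap l r u) = ((n : ℝ) ^ 2 - 2 * n) * h u + 2 * ∑ r, h r := by
  -- When `l = r = u` both corrections vanish, so they can be added without excluding the overlap.
  have key : ∀ l r, h (Equiv.swap l r u) = h u + (if l = u then h r - h u else 0)
      + (if r = u then h l - h u else 0) := fun l r => by
    by_cases hl : l = u
    · subst hl
      by_cases hr : r = l
      · subst hr; simp
      · simp [hr]
    · by_cases hr : r = u
      · subst hr; simp [hl]
      · rw [Equiv.swap_apply_of_ne_of_ne (Ne.symm hl) (Ne.symm hr)]; simp [hl, hr]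
  simp only [key, Finset.sum_add_distrib, Finset.sum_ite_eq', Finset.mem_univ, if_true]
  have e : ∑ l : Fin n, ∑ r : Fin n, (if l = u then h r - h u else 0) = ∑ r, (h r - h u) := by
    rw [Finset.sum_comm]; simp
  rw [e]
  simp
  ring

/-- The law of a function whose value after a step is governed by a single uniform location. -/
theorem avgStep_iterate_of_eigen [NeZero n] {f : Equiv.Perm (Fin n) → ℝ} {m : ℝ}
    (h : ∀ σ, avgStep f σ = (1 - 2 / n) * f σ + 2 / n * m) (σ : Equiv.Perm (Fin n)) (t : ℕ) :
    avgStep^[t] f σ = (1 - 2 / n) ^ t * (f σ - m) + m := by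
  have hn : (n : ℝ) ≠ 0 := Nat.cast_ne_zero.2 (NeZero.ne n)
  induction t generalizing σ with
  | zero => simp
  | succ t ih =>
    have e : avgStep^[t] f = fun τ => (1 - 2 / n : ℝ) ^ t * (f τ - m) + m := funext ih
    have h' := h σ
    rw [avgStep, div_eq_iff (pow_ne_zero 2 hn)] at h'
    rw [Function.iterate_succ_apply', e, avgStep, div_eq_iff (pow_ne_zero 2 hn)]
    simp only [Finset.sum_add_distrib, ← Finset.mul_sum, Finset.sum_sub_distrib, h', pow_succ]
    generalize (1 - 2 / n : ℝ) ^ t = x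
    simp
    field_simp
    ring

theorem avgStep_apply_location [NeZero n] (g : Fin n → ℝ) (u : Fin n) (σ : Equiv.Perm (Fin n))
    (t : ℕ) : avgStep^[t] (fun τ => g (τ u)) σ
      = (1 - 2 / n) ^ t * (g (σ u) - (∑ c, g c) / n) + (∑ c, g c) / n := by
  have hn : (n : ℝ) ≠ 0 := Nat.cast_ne_zero.2 (NeZero.ne n)
  refine avgStep_iterate_of_eigen (f := fun τ => g (τ u)) (fun σ => ?_) σ t
  have := sum_swap_apply (fun v => g (σ v)) u
  rw [Equiv.sum_comp σ g] at this
  simp only [avgStep, Equiv.Perm.mul_apply, this]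
  field_simp

theorem avgStep_inv_apply_card [NeZero n] (g : Fin n → ℝ) (c : Fin n) (σ : Equiv.Perm (Fin n))
    (t : ℕ) : avgStep^[t] (fun τ => g (τ⁻¹ c)) σ
      = (1 - 2 / n) ^ t * (g (σ⁻¹ c) - (∑ u, g u) / n) + (∑ u, g u) / n := by
  have hn : (n : ℝ) ≠ 0 := Nat.cast_ne_zero.2 (NeZero.ne n)
  refine avgStep_iterate_of_eigen (f := fun τ => g (τ⁻¹ c)) (fun σ => ?_) σ t
  have := sum_swap_apply g (σ⁻¹ c)
  simp only [avgStep, mul_inv_rev, Equiv.swap_inv, Equiv.Perm.mul_apply, this]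
  field_simp

end avgStep

/-! ### Upper bound by a conjugation coupling. -/

/-- The locations of the cards in `C`. -/
def locations {n : ℕ} (C : Finset (Fin n)) (σ : Equiv.Perm (Fin n)) : C → Fin n :=
  fun c => σ⁻¹ (c : Fin n)

section bounds

variable {n : ℕ}

theorem expect_locationLaw [NeZero n] (C : Finset (Fin n)) (σ : Equiv.Perm (Fin n)) (t : ℕ)
    (g : (C → Fin n) → ℝ) :
    expect (locationLaw C (deckLaw (randomToRandom n) σ t)) g
      = avgStep^[t] (fun τ => g (locations C τ)) σ := by
  rw [locationLaw, expect_map, ← expect_deckLaw]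
  rfl

theorem expect_locationLaw_uniform (C : Finset (Fin n)) (g : (C → Fin n) → ℝ) :
    expect (locationLaw C (PMF.uniformOfFintype (Equiv.Perm (Fin n)))) g
      = (∑ σ, g (locations C σ)) / Fintype.card (Equiv.Perm (Fin n)) := by
  rw [locationLaw, expect_map, expect_uniform]
  rfl

/-- By stationarity the uniform expectation is the average over starting decks `σ'`, so comparing
two starting decks suffices. -/
theorem cardDist_le [NeZero n] {C : Finset (Fin n)} {t : ℕ} {B : ℝ}
    (h : ∀ g : (C → Fin n) → ℝ, (∀ x, |g x| ≤ 1) → ∀ σ σ' : Equiv.Perm (Fin n),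
      avgStep^[t] (fun τ => g (locations C τ)) σ - avgStep^[t] (fun τ => g (locations C τ)) σ'
        ≤ 2 * B) :
    cardDist (randomToRandom n) C t ≤ B := by
  refine ciSup_le fun σ => tvDist_le fun g hg => ?_
  have hN : (0 : ℝ) < Fintype.card (Equiv.Perm (Fin n)) := Nat.cast_pos.2 Fintype.card_pos
  rw [expect_locationLaw, expect_locationLaw_uniform,
    ← sum_avgStep (fun τ => g (locations C τ)) t, sub_le_iff_le_add, ← sub_le_iff_le_add',
    le_div_iff₀ hN]
  calc _ = ∑ σ' : Equiv.Perm (Fin n),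
        (avgStep^[t] (fun τ => g (locations C τ)) σ - 2 * B) := by
          simp; ring
    _ ≤ _ := Finset.sum_le_sum fun σ' _ => by linarith [h g hg σ σ']

theorem bddAbove_tvDist [NeZero n] (ℓ : ℕ → PMF (Fin n)) (C : Finset (Fin n)) (t : ℕ) :
    BddAbove (Set.range fun σ₀ : Equiv.Perm (Fin n) =>
      tvDist (locationLaw C (deckLaw ℓ σ₀ t))
        (locationLaw C (PMF.uniformOfFintype (Equiv.Perm (Fin n))))) :=
  ⟨1, by rintro _ ⟨σ, rfl⟩; exact tvDist_le_one _ _⟩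

theorem cardDist_nonneg [NeZero n] (ℓ : ℕ → PMF (Fin n)) (C : Finset (Fin n)) (t : ℕ) :
    0 ≤ cardDist ℓ C t :=
  Real.iSup_nonneg fun _ => tvDist_nonneg _ _

theorem cardDist_le_one [NeZero n] (ℓ : ℕ → PMF (Fin n)) (C : Finset (Fin n)) (t : ℕ) :
    cardDist ℓ C t ≤ 1 :=
  ciSup_le fun _ => tvDist_le_one _ _

theorem partialDist_nonneg [NeZero n] (ℓ : ℕ → PMF (Fin n)) (k t : ℕ) : 0 ≤ partialDist ℓ k t :=
  Real.iSup_nonneg fun _ => cardDist_nonneg _ _ _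

theorem partialDist_le_one [NeZero n] (ℓ : ℕ → PMF (Fin n)) (k t : ℕ) : partialDist ℓ k t ≤ 1 :=
  Real.iSup_le (fun _ => cardDist_le_one _ _ _) zero_le_one

theorem cardDist_le_partialDist [NeZero n] (ℓ : ℕ → PMF (Fin n)) {k : ℕ} (t : ℕ)
    {C : Finset (Fin n)} (hC : C.card = k) : cardDist ℓ C t ≤ partialDist ℓ k t :=
  le_ciSup (f := fun C : {C : Finset (Fin n) // C.card = k} => cardDist ℓ C.1 t)
    ⟨1, by rintro _ ⟨σ, rfl⟩; exact cardDist_le_one _ _ _⟩ ⟨C, hC⟩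

theorem one_sub_two_div_nonneg (hn : 2 ≤ n) : 0 ≤ 1 - 2 / (n : ℝ) := by
  have : (2 : ℝ) ≤ n := by exact_mod_cast hn
  rw [sub_nonneg, div_le_one (by linarith)]
  exact this

theorem cardDist_singleton_le [NeZero n] (hn : 2 ≤ n) (i : Fin n) (t : ℕ) :
    cardDist (randomToRandom n) {i} t ≤ (1 - 2 / n : ℝ) ^ t := by
  refine cardDist_le fun g hg σ σ' => ?_
  have e : (fun τ : Equiv.Perm (Fin n) => g (locations {i} τ))
      = fun τ => (fun u => g fun _ => u) (τ⁻¹ i) := by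
    funext τ
    congr 1
    funext c
    rw [locations, Finset.mem_singleton.1 c.2]
  rw [e, avgStep_inv_apply_card (fun u => g fun _ => u),
    avgStep_inv_apply_card (fun u => g fun _ => u)]
  have hp := pow_nonneg (one_sub_two_div_nonneg hn) t
  have h1 := (abs_le.1 (hg fun _ => σ⁻¹ i)).2
  have h2 := (abs_le.1 (hg fun _ => σ'⁻¹ i)).1
  have := mul_le_mul_of_nonneg_left (a := (1 - 2 / n : ℝ) ^ t)
    (show g (fun _ => σ⁻¹ i) - g (fun _ => σ'⁻¹ i) ≤ 2 by linarith) hp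
  linarith

/-- A permutation agreeing with `τ` on `A` can be chosen to fix everything outside
`A ∪ τ '' A`. -/
theorem exists_perm_eqOn {α : Type*} [DecidableEq α] (τ : Equiv.Perm α) (A : Finset α) :
    ∃ π : Equiv.Perm α, (∀ a ∈ A, π a = τ a) ∧ ∀ x, x ∉ A ∪ A.image τ → π x = x := by
  induction A using Finset.induction_on with
  | empty => exact ⟨1, by simp, by simp⟩
  | insert a A ha ih =>
    obtain ⟨π, h1, h2⟩ := ih
    refine ⟨Equiv.swap (π a) (τ a) * π, fun b hb => ?_, fun x hx => ?_⟩
    · rw [Equiv.Perm.mul_apply]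
      rcases Finset.mem_insert.1 hb with rfl | hb
      · rw [Equiv.swap_apply_left]
      · have hne : b ≠ a := fun h => ha (h ▸ hb)
        rw [Equiv.swap_apply_of_ne_of_ne (π.injective.ne hne), h1 b hb]
        rw [h1 b hb]
        exact τ.injective.ne hne
    · simp only [Finset.mem_union, Finset.mem_insert, Finset.image_insert, not_or] at hx
      obtain ⟨⟨hxa, hxA⟩, hxt, hxi⟩ := hx
      have hπ : π x = x := h2 x (by simp only [Finset.mem_union, not_or]; exact ⟨hxA, hxi⟩)
      rw [Equiv.Perm.mul_apply, Equiv.swap_apply_of_ne_of_ne (π.injective.ne hxa), hπ]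
      rwa [hπ]

/-- Only the locations of `C` in the two decks need to move, at most `C.card` in each. -/
theorem exists_perm_locations (C : Finset (Fin n)) (σ σ' : Equiv.Perm (Fin n)) :
    ∃ ρ : Equiv.Perm (Fin n), ρ.support.card ≤ 2 * C.card ∧
      ∀ c ∈ C, (σ * ρ)⁻¹ c = σ'⁻¹ c := by
  obtain ⟨π, h1, h2⟩ := exists_perm_eqOn (σ'⁻¹ * σ) (C.image ⇑σ⁻¹)
  refine ⟨π⁻¹, ?_, fun c hc => ?_⟩
  · rw [Equiv.Perm.support_inv]
    calc π.support.card ≤ (C.image ⇑σ⁻¹ ∪ (C.image ⇑σ⁻¹).image ⇑(σ'⁻¹ * σ)).card := by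
          refine Finset.card_le_card fun x hx => ?_
          by_contra hx'
          exact Equiv.Perm.mem_support.1 hx (h2 x hx')
      _ ≤ C.card + C.card := (Finset.card_union_le _ _).trans
          (add_le_add Finset.card_image_le (Finset.card_image_le.trans Finset.card_image_le))
      _ = 2 * C.card := (two_mul _).symm
  · have := h1 (σ⁻¹ c) (Finset.mem_image_of_mem _ hc)
    simpa using this

/-- Decks in which the cards of `C` have the same locations remain indistinguishable. -/
theorem avgStep_eq_of_locations_eq [NeZero n] {C : Finset (Fin n)} (g : (C → Fin n) → ℝ)
    {σ σ' : Equiv.Perm (Fin n)} (h : ∀ c ∈ C, σ⁻¹ c = σ'⁻¹ c) (t : ℕ) :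
    avgStep^[t] (fun τ => g (locations C τ)) σ = avgStep^[t] (fun τ => g (locations C τ)) σ' := by
  induction t generalizing σ σ' with
  | zero => exact congrArg g (funext fun c => h c c.2)
  | succ t ih =>
    simp only [Function.iterate_succ', Function.comp_apply, avgStep]
    congr 1
    refine Finset.sum_congr rfl fun l _ => Finset.sum_congr rfl fun r _ => ih fun c hc => ?_
    rw [mul_inv_rev, mul_inv_rev, Equiv.Perm.mul_apply, Equiv.Perm.mul_apply, h c hc]

/-- A test function separates `τ` from `τ * ρ` only if a card of `C` lies in the support of `ρ`; the
bound is the expected number of such cards. -/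
theorem cardDist_le_card [NeZero n] (hn : 2 ≤ n) (C : Finset (Fin n)) (t : ℕ) :
    cardDist (randomToRandom n) C t
      ≤ 2 * C.card * ((1 - 2 / n : ℝ) ^ t + C.card / n) := by
  refine cardDist_le fun g hg σ σ' => ?_
  obtain ⟨ρ, hρ, hloc⟩ := exists_perm_locations C σ σ'
  set f : Equiv.Perm (Fin n) → ℝ := fun τ => g (locations C τ)
  set occ : Fin n → ℝ := fun c => if c ∈ C then 1 else 0
  have hp := pow_nonneg (one_sub_two_div_nonneg hn) t
  have hocc : ∀ c, 0 ≤ occ c := fun c => by simp only [occ]; split_ifs <;> norm_num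
  have hsum : ∑ c, occ c = C.card := by simp [occ]
  have hle : ∀ τ, f τ - f (τ * ρ) ≤ 2 * ∑ u ∈ ρ.support, occ (τ u) := fun τ => by
    by_cases h : ∃ u ∈ ρ.support, τ u ∈ C
    · obtain ⟨u, hu, huC⟩ := h
      have h1 : occ (τ u) ≤ ∑ u ∈ ρ.support, occ (τ u) :=
        Finset.single_le_sum (f := fun u => occ (τ u)) (fun v _ => hocc _) hu
      rw [show occ (τ u) = 1 from if_pos huC] at h1
      linarith [(abs_le.1 (hg (locations C τ))).2, (abs_le.1 (hg (locations C (τ * ρ)))).1]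
    · push Not at h
      have : locations C (τ * ρ) = locations C τ := by
        funext c
        have hc : τ⁻¹ (c : Fin n) ∉ ρ.support := fun hu => h _ hu (by simp)
        rw [locations, locations, mul_inv_rev, Equiv.Perm.mul_apply, Equiv.Perm.inv_eq_iff_eq]
        exact (Equiv.Perm.notMem_support.1 hc).symm
      simp only [f, this, sub_self]
      exact mul_nonneg zero_le_two (Finset.sum_nonneg fun u _ => hocc _)
  calc avgStep^[t] f σ - avgStep^[t] f σ'
      = avgStep^[t] (fun τ => f τ - f (τ * ρ)) σ := by
        rw [← avgStep_eq_of_locations_eq g hloc t, avgStep_mul_right, ← expect_deckLaw,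
          ← expect_deckLaw, ← expect_deckLaw, expect_sub]
    _ ≤ avgStep^[t] (fun τ => 2 * ∑ u ∈ ρ.support, occ (τ u)) σ := avgStep_mono hle σ t
    _ = 2 * ∑ u ∈ ρ.support, avgStep^[t] (fun τ => occ (τ u)) σ := avgStep_sum_mul _ _ _ _ _
    _ ≤ 2 * ∑ u ∈ ρ.support, ((1 - 2 / n : ℝ) ^ t + C.card / n) := by
        gcongr with u hu
        rw [avgStep_apply_location, hsum]
        have h1 : occ (σ u) - C.card / n ≤ 1 := by
          have : (0 : ℝ) ≤ C.card / n := by positivity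
          have : occ (σ u) ≤ 1 := by simp only [occ]; split_ifs <;> norm_num
          linarith
        linarith [mul_le_mul_of_nonneg_left h1 hp]
    _ = 2 * (ρ.support.card * ((1 - 2 / n : ℝ) ^ t + C.card / n)) := by
        rw [Finset.sum_const, nsmul_eq_mul]
    _ ≤ 2 * ((2 * C.card : ℕ) * ((1 - 2 / n : ℝ) ^ t + C.card / n)) := by gcongr
    _ = _ := by push_cast; ring

theorem partialDist_le [NeZero n] (hn : 2 ≤ n) (k t : ℕ) :
    partialDist (randomToRandom n) k t ≤ 2 * k * ((1 - 2 / n : ℝ) ^ t + k / n) := by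
  have hp := pow_nonneg (one_sub_two_div_nonneg hn) t
  refine Real.iSup_le (fun C => ?_) (by positivity)
  simpa only [C.2] using cardDist_le_card hn C.1 t


end bounds

/-! ### Lower bound by untouched cards. -/

section lowerBound

variable {n : ℕ}

theorem sum_not_mem_or (s : Finset (Fin n)) :
    ∑ l, ∑ r, (if l ∈ s ∨ r ∈ s then (0 : ℝ) else 1) = ((n : ℝ) - s.card) ^ 2 := by
  have e : ∑ l : Fin n, (if l ∈ s then (0 : ℝ) else 1) = n - s.card := by
    have : ∀ l : Fin n, (if l ∈ s then (0 : ℝ) else 1) = 1 - if l ∈ s then 1 else 0 :=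
      fun l => by split_ifs <;> simp
    simp only [this, Finset.sum_sub_distrib]
    simp
  rw [sq, ← e, Finset.sum_mul_sum]
  refine Finset.sum_congr rfl fun l _ => Finset.sum_congr rfl fun r _ => ?_
  by_cases h1 : l ∈ s <;> by_cases h2 : r ∈ s <;> simp [h1, h2]

theorem card_sdiff_pair_eq_sum (A : Finset (Fin n)) (l r : Fin n) :
    ((A \ {l, r}).card : ℝ)
      = ∑ a ∈ A, if l ∈ ({a} : Finset _) ∨ r ∈ ({a} : Finset _) then 0 else 1 := by
  rw [Finset.card_eq_sum_ones, Finset.sdiff_eq_filter, Finset.sum_filter]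
  push_cast
  refine Finset.sum_congr rfl fun a _ => ?_
  by_cases h1 : l = a <;> by_cases h2 : r = a <;> simp [h1, h2, Ne.symm]

theorem sum_card_sdiff_pair (A : Finset (Fin n)) :
    ∑ l, ∑ r, ((A \ {l, r}).card : ℝ) = A.card * ((n : ℝ) - 1) ^ 2 := by
  have e := fun a : Fin n => sum_not_mem_or ({a} : Finset (Fin n))
  simp only [card_sdiff_pair_eq_sum]
  rw [Finset.sum_congr rfl fun l _ => Finset.sum_comm, Finset.sum_comm]
  simp only [e]
  simp

/-- Expanding the square over pairs in `A`: the diagonal counts hands avoiding one point, the rest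
hands avoiding two. -/
theorem sum_card_sdiff_pair_sq (A : Finset (Fin n)) :
    ∑ l, ∑ r, ((A \ {l, r}).card : ℝ) ^ 2
      = A.card * ((n : ℝ) - 1) ^ 2 + ((A.card : ℝ) ^ 2 - A.card) * ((n : ℝ) - 2) ^ 2 := by
  have h : ∀ l r : Fin n, ((A \ {l, r}).card : ℝ) ^ 2 = ∑ x ∈ A ×ˢ A,
      if l ∈ ({x.1, x.2} : Finset (Fin n)) ∨ r ∈ ({x.1, x.2} : Finset (Fin n)) then 0 else 1 :=
    fun l r => by
      rw [card_sdiff_pair_eq_sum, sq, Finset.sum_mul_sum, ← Finset.sum_product']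
      refine Finset.sum_congr rfl fun x _ => ?_
      by_cases h1 : l = x.1 <;> by_cases h2 : r = x.1 <;> by_cases h3 : l = x.2 <;>
        by_cases h4 : r = x.2 <;> simp [h1, h2, h3, h4]
  have e := fun x : Fin n × Fin n => sum_not_mem_or ({x.1, x.2} : Finset (Fin n))
  have e' : ∀ a b : Fin n, ((n : ℝ) - (({a, b} : Finset (Fin n)).card : ℝ)) ^ 2
      = ((n : ℝ) - 2) ^ 2 + if a = b then ((n : ℝ) - 1) ^ 2 - ((n : ℝ) - 2) ^ 2 else 0 :=
    fun a b => by
      split_ifs with hab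
      · subst hab; simp
      · rw [Finset.card_pair hab]; simp
  simp only [h]
  rw [Finset.sum_congr rfl fun l _ => Finset.sum_comm, Finset.sum_comm]
  simp only [e, e', Finset.sum_add_distrib]
  rw [Finset.sum_product' A A fun a b => if a = b then ((n : ℝ) - 1) ^ 2 - ((n : ℝ) - 2) ^ 2 else 0]
  simp [Finset.sum_ite_eq, Finset.sum_ite_mem]
  ring

/-- The indicator of the event that a card of `C` is at the location with its own label. -/
def someFixed (C : Finset (Fin n)) (x : C → Fin n) : ℝ := if ∃ c, x c = c then 1 else 0

theorem someFixed_nonneg (C : Finset (Fin n)) (x : C → Fin n) : 0 ≤ someFixed C x := by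
  unfold someFixed; split_ifs <;> norm_num

theorem someFixed_le_one (C : Finset (Fin n)) (x : C → Fin n) : someFixed C x ≤ 1 := by
  unfold someFixed; split_ifs <;> norm_num

/-- Second moment bound: for `N` the number of cards of `A` not yet touched, `someFixed C` is at
least `2cN - c²N²`, whose expectation is explicit. -/
theorem le_avgStep_someFixed [NeZero n] (c : ℝ) (C A : Finset (Fin n)) (hA : A ⊆ C)
    (σ : Equiv.Perm (Fin n)) (hσ : ∀ a ∈ A, σ a = a) (t : ℕ) :
    2 * c * A.card * ((1 - 1 / n : ℝ) ^ 2) ^ t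
      - c ^ 2 * (((A.card : ℝ) ^ 2 - A.card) * ((1 - 2 / n : ℝ) ^ 2) ^ t
        + A.card * ((1 - 1 / n : ℝ) ^ 2) ^ t)
      ≤ avgStep^[t] (fun τ => someFixed C (locations C τ)) σ := by
  have hn : (n : ℝ) ≠ 0 := Nat.cast_ne_zero.2 (NeZero.ne n)
  induction t generalizing σ A with
  | zero =>
    simp only [pow_zero, Function.iterate_zero, id]
    rcases A.eq_empty_or_nonempty with rfl | ⟨a, ha⟩
    · simpa using someFixed_nonneg C (locations C σ)
    · have : someFixed C (locations C σ) = 1 :=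
        if_pos ⟨⟨a, hA ha⟩, by
          rw [locations, Equiv.Perm.inv_eq_iff_eq]; exact (hσ a ha).symm⟩
      rw [this]
      -- This is `2x - x² ≤ 1` at `x = c * A.card`.
      nlinarith [sq_nonneg (1 - c * A.card)]
  | succ t ih =>
    rw [Function.iterate_succ_apply', avgStep, le_div_iff₀ (by positivity)]
    -- Conditioning on the first step: cards of `A` away from both hands stay at their labels and
    -- form the new untouched set.
    have hstep := fun l r => ih (A \ {l, r}) (Finset.sdiff_subset.trans hA)
      (σ * Equiv.swap l r) fun a ha => by
        simp only [Finset.mem_sdiff, Finset.mem_insert, Finset.mem_singleton, not_or] at ha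
        rw [Equiv.Perm.mul_apply, Equiv.swap_apply_of_ne_of_ne ha.2.1 ha.2.2, hσ a ha.1]
    refine le_trans (le_of_eq ?_)
      (Finset.sum_le_sum fun l _ => Finset.sum_le_sum fun r _ => hstep l r)
    simp only [Finset.sum_sub_distrib, Finset.sum_add_distrib, ← Finset.mul_sum, ← Finset.sum_mul,
      sum_card_sdiff_pair, sum_card_sdiff_pair_sq, pow_succ _ t]
    generalize ((1 - 1 / n : ℝ) ^ 2) ^ t = x
    generalize ((1 - 2 / n : ℝ) ^ 2) ^ t = y
    field_simp
    ring

theorem expect_someFixed_uniform_le [NeZero n] (C : Finset (Fin n)) :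
    expect (locationLaw C (PMF.uniformOfFintype (Equiv.Perm (Fin n)))) (someFixed C)
      ≤ C.card / n := by
  have hn : (n : ℝ) ≠ 0 := Nat.cast_ne_zero.2 (NeZero.ne n)
  have hone : ∀ c : Fin n, ∑ σ : Equiv.Perm (Fin n), (if σ⁻¹ c = c then (1 : ℝ) else 0)
      = Fintype.card (Equiv.Perm (Fin n)) / n := fun c => by
    -- Relabelling locations by a swap shows that a card is equally likely to be anywhere.
    have hc : ∀ u : Fin n, ∑ σ : Equiv.Perm (Fin n), (if σ⁻¹ c = u then (1 : ℝ) else 0)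
        = ∑ σ : Equiv.Perm (Fin n), (if σ⁻¹ c = c then (1 : ℝ) else 0) := fun u => by
      rw [← Equiv.sum_comp (Equiv.mulRight (Equiv.swap u c))]
      refine Finset.sum_congr rfl fun σ _ => ?_
      simp only [Equiv.coe_mulRight, mul_inv_rev, Equiv.swap_inv, Equiv.Perm.mul_apply]
      congr 1
      rw [Equiv.swap_apply_eq_iff, Equiv.swap_apply_left]
    rw [eq_div_iff hn]
    calc _ = ∑ u : Fin n, ∑ σ : Equiv.Perm (Fin n), (if σ⁻¹ c = u then (1 : ℝ) else 0) := by
          simp only [hc]; simp [mul_comm]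
      _ = _ := by rw [Finset.sum_comm]; simp
  rw [expect_locationLaw_uniform, div_le_iff₀ (Nat.cast_pos.2 Fintype.card_pos)]
  calc ∑ σ, someFixed C (locations C σ)
      ≤ ∑ σ : Equiv.Perm (Fin n), ∑ c ∈ C, (if σ⁻¹ c = c then (1 : ℝ) else 0) := by
        refine Finset.sum_le_sum fun σ _ => ?_
        have h0 : ∀ c ∈ C, 0 ≤ (if σ⁻¹ c = c then (1 : ℝ) else 0) := fun c _ => by
          split_ifs <;> norm_num
        unfold someFixed
        split_ifs with h
        · obtain ⟨c, hc⟩ := h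
          have := Finset.single_le_sum h0 c.2
          rwa [if_pos (show σ⁻¹ (c : Fin n) = c from hc)] at this
        · exact Finset.sum_nonneg h0
    _ = ∑ c ∈ C, (Fintype.card (Equiv.Perm (Fin n)) / n : ℝ) := by
        rw [Finset.sum_comm]; simp only [hone]
    _ = _ := by rw [Finset.sum_const, nsmul_eq_mul]; ring

theorem le_partialDist [NeZero n] (c : ℝ) {a k : ℕ} (hak : a ≤ k) (hk : k ≤ n) (t : ℕ) :
    2 * c * a * ((1 - 1 / n : ℝ) ^ 2) ^ t
      - c ^ 2 * (((a : ℝ) ^ 2 - a) * ((1 - 2 / n : ℝ) ^ 2) ^ t + a * ((1 - 1 / n : ℝ) ^ 2) ^ t)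
      - k / n ≤ partialDist (randomToRandom n) k t := by
  obtain ⟨C, -, hC⟩ := Finset.exists_subset_card_eq (s := (Finset.univ : Finset (Fin n)))
    (by simpa using hk)
  obtain ⟨A, hAC, hA⟩ := Finset.exists_subset_card_eq (hak.trans hC.ge)
  refine le_trans ?_ (cardDist_le_partialDist _ t hC)
  refine le_trans ?_ (le_ciSup (bddAbove_tvDist _ C t) 1)
  refine le_trans ?_ (expect_sub_le_tvDist _ _ (someFixed_nonneg C) (someFixed_le_one C))
  have h1 := le_avgStep_someFixed c C A hAC 1 (fun _ _ => rfl) t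
  have h2 := expect_someFixed_uniform_le C
  rw [hA] at h1
  rw [hC] at h2
  rw [expect_locationLaw]
  linarith

/-- With high probability some card has not been touched before the coupon collector time. -/
theorem one_sub_le_partialDist [NeZero n] (hn : 2 ≤ n) {k : ℕ} (hk0 : 0 < k) (hk : k ≤ n)
    (t : ℕ) :
    1 - 1 / (k * (1 - 1 / n : ℝ) ^ (2 * t)) - k / n ≤ partialDist (randomToRandom n) k t := by
  have hn' : (2 : ℝ) ≤ n := by exact_mod_cast hn
  have hk' : (1 : ℝ) ≤ k := by exact_mod_cast hk0
  -- Survival of two cards is negatively correlated, since `1 - 2/n ≤ (1 - 1/n)²`.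
  have hle : (1 - 2 / n : ℝ) ^ 2 ≤ ((1 - 1 / n : ℝ) ^ 2) ^ 2 := by
    have h1 : (0 : ℝ) ≤ 1 - 2 / n := one_sub_two_div_nonneg hn
    refine pow_le_pow_left₀ h1 ?_ 2
    have : (1 - 1 / n : ℝ) ^ 2 = 1 - 2 / n + (1 / n) ^ 2 := by ring
    linarith [sq_nonneg (1 / n : ℝ)]
  have hpos : (0 : ℝ) < (1 - 1 / n : ℝ) ^ 2 := by
    have : (1 : ℝ) / n < 1 := by rw [div_lt_one] <;> linarith
    have : (0 : ℝ) < 1 - 1 / n := by linarith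
    positivity
  rw [pow_mul]
  set θ : ℝ := (1 - 1 / n : ℝ) ^ 2
  have hη : ((1 - 2 / n : ℝ) ^ 2) ^ t ≤ (θ ^ t) ^ 2 := by
    rw [pow_right_comm θ]
    exact pow_le_pow_left₀ (sq_nonneg _) hle t
  have hx : 0 < θ ^ t := pow_pos hpos t
  -- The constant `c` is the reciprocal of the mean number of untouched cards.
  have := le_partialDist (1 / (k * θ ^ t)) le_rfl hk t
  refine le_trans ?_ this
  have e : 1 - 1 / (k * θ ^ t) - (k : ℝ) / n ≤ 2 * (1 / (k * θ ^ t)) * k * θ ^ t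
      - (1 / (k * θ ^ t)) ^ 2 * (((k : ℝ) ^ 2 - k) * (θ ^ t) ^ 2 + k * θ ^ t) - k / n := by
    have : 2 * (1 / (k * θ ^ t)) * k * θ ^ t
      - (1 / (k * θ ^ t)) ^ 2 * (((k : ℝ) ^ 2 - k) * (θ ^ t) ^ 2 + k * θ ^ t)
      = 1 - 1 / (k * θ ^ t) + 1 / k := by
      field_simp
      ring
    rw [this]
    have : (0 : ℝ) < 1 / k := by positivity
    linarith
  refine e.trans ?_
  have hkk : (0 : ℝ) ≤ (k : ℝ) ^ 2 - k := by nlinarith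
  gcongr

/-- Tracking a single card: this stays useful when `k` is bounded, where the second moment bound may
be vacuous. -/
theorem pow_sub_le_partialDist [NeZero n] {k : ℕ} (hk0 : 0 < k) (hk : k ≤ n) (t : ℕ) :
    (1 - 1 / n : ℝ) ^ (2 * t) - k / n ≤ partialDist (randomToRandom n) k t := by
  have := le_partialDist 1 (Nat.one_le_iff_ne_zero.2 hk0.ne') hk t
  rw [pow_mul]
  refine le_trans (le_of_eq ?_) this
  push_cast
  ring

end lowerBound

/-! ### Real times and exponential estimates. -/

theorem distAt_of_ne_zero (S : Shuffle) (n : ℕ) [NeZero n] (k : ℕ) (s : ℝ) :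
    distAt S n k s = partialDist (S n) k ⌊s⌋₊ :=
  dif_neg (NeZero.ne n)

theorem distAt_nonneg (S : Shuffle) (n k : ℕ) (s : ℝ) : 0 ≤ distAt S n k s := by
  unfold distAt
  split_ifs with h
  · exact le_rfl
  · exact @partialDist_nonneg n ⟨h⟩ _ _ _

theorem distAt_le_one (S : Shuffle) (n k : ℕ) (s : ℝ) : distAt S n k s ≤ 1 := by
  unfold distAt
  split_ifs with h
  · exact zero_le_one
  · exact @partialDist_le_one n ⟨h⟩ _ _ _

theorem pow_le_exp_neg {n : ℕ} (hn : 2 ≤ n) (t : ℕ) :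
    (1 - 2 / n : ℝ) ^ t ≤ Real.exp (-2 * t / n) := by
  calc (1 - 2 / n : ℝ) ^ t ≤ Real.exp (-(2 / n)) ^ t :=
        pow_le_pow_left₀ (one_sub_two_div_nonneg hn) (Real.one_sub_le_exp_neg _) t
    _ = _ := by rw [← Real.exp_nat_mul]; congr 1; ring

theorem exp_neg_le_pow {n : ℕ} (hn : 2 ≤ n) (t : ℕ) :
    Real.exp (-(2 * t / (n - 1))) ≤ (1 - 1 / n : ℝ) ^ (2 * t) := by
  have hn' : (2 : ℝ) ≤ n := by exact_mod_cast hn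
  have h1 : (0 : ℝ) < n - 1 := by linarith
  have h : Real.exp (-(1 / (n - 1 : ℝ))) ≤ 1 - 1 / n := by
    have e : (1 - 1 / n : ℝ) = (1 / (n - 1 : ℝ) + 1)⁻¹ := by field_simp; ring
    rw [e, Real.exp_neg]
    exact inv_anti₀ (by positivity) (Real.add_one_le_exp _)
  refine le_trans (le_of_eq ?_) (pow_le_pow_left₀ (Real.exp_pos _).le h (2 * t))
  rw [← Real.exp_nat_mul]
  congr 1
  push_cast
  ring

/-- The factor `Real.exp 2` pays for rounding the time down, which loses less than one step. -/
theorem distAt_le {n : ℕ} (hn : 2 ≤ n) (k : ℕ) (s : ℝ) :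
    distAt randomToRandom n k s ≤ 2 * k * (Real.exp 2 * Real.exp (-2 * s / n) + k / n) := by
  have : NeZero n := ⟨by omega⟩
  have hn' : (2 : ℝ) ≤ n := by exact_mod_cast hn
  rw [distAt_of_ne_zero]
  refine (partialDist_le hn k _).trans ?_
  gcongr
  refine (pow_le_exp_neg hn _).trans ?_
  rw [← Real.exp_add, Real.exp_le_exp, div_le_iff₀ (by linarith), add_mul,
    div_mul_cancel₀ _ (by linarith)]
  linarith [Nat.lt_floor_add_one s]

theorem exp_neg_le_pow_floor {n : ℕ} (hn : 2 ≤ n) {s S : ℝ} (hs : s ≤ S) (hS : 0 ≤ S) :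
    Real.exp (-(2 * S / (n - 1))) ≤ (1 - 1 / n : ℝ) ^ (2 * ⌊s⌋₊) := by
  have hn' : (2 : ℝ) ≤ n := by exact_mod_cast hn
  refine le_trans ?_ (exp_neg_le_pow hn _)
  have : (⌊s⌋₊ : ℝ) ≤ S :=
    (Nat.cast_le.2 (Nat.floor_le_floor hs)).trans (Nat.floor_le hS)
  have h1 : (0 : ℝ) ≤ n - 1 := by linarith
  gcongr

theorem isBoundedUnder_le_distAt (S : Shuffle) (k : ℕ → ℕ) (s : ℕ → ℝ) :
    IsBoundedUnder (· ≤ ·) atTop fun n => distAt S n (k n) (s n) :=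
  isBoundedUnder_of ⟨1, fun _ => distAt_le_one _ _ _ _⟩

theorem isBoundedUnder_ge_distAt (S : Shuffle) (k : ℕ → ℕ) (s : ℕ → ℝ) :
    IsBoundedUnder (· ≥ ·) atTop fun n => distAt S n (k n) (s n) :=
  isBoundedUnder_of ⟨0, fun _ => distAt_nonneg _ _ _ _⟩

/-! ### Cutoff for growing `k`. -/

/-- The logarithm in the hypothesis is used only through `1 ≤ log n`; the cutoff argument needs just
`k² = o(n)`. -/
theorem tendsto_sq_div {k : ℕ → ℕ}
    (hk : (fun n : ℕ => (k n : ℝ)) =o[atTop] fun n : ℕ => ((n : ℝ) / Real.log n) ^ (1 / 2 : ℝ)) :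
    Tendsto (fun n : ℕ => (k n : ℝ) ^ 2 / n) atTop (𝓝 0) := by
  have h1 : (fun n : ℕ => (k n : ℝ) ^ 2) =o[atTop] fun n : ℕ => (n : ℝ) := by
    refine (hk.pow two_pos).trans_isBigO (IsBigO.of_bound 1 ?_)
    have hlog := (Real.tendsto_log_atTop.comp tendsto_natCast_atTop_atTop).eventually_ge_atTop 1
    filter_upwards [hlog] with n hn
    have hn : 1 ≤ Real.log n := hn
    have h0 : (0 : ℝ) ≤ n / Real.log n := by positivity
    rw [← Real.sqrt_eq_rpow, Real.sq_sqrt h0, Real.norm_of_nonneg h0,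
      Real.norm_of_nonneg (Nat.cast_nonneg n), one_mul]
    exact div_le_self (Nat.cast_nonneg n) hn
  exact h1.tendsto_div_nhds_zero

theorem tendsto_div_of_sq_div {k : ℕ → ℕ}
    (hk : Tendsto (fun n : ℕ => (k n : ℝ) ^ 2 / n) atTop (𝓝 0)) :
    Tendsto (fun n : ℕ => (k n : ℝ) / n) atTop (𝓝 0) := by
  refine squeeze_zero (fun n => by positivity) (fun n => ?_) hk
  gcongr
  exact_mod_cast Nat.le_self_pow two_ne_zero (k n)

theorem eventually_le_of_tendsto_div {k : ℕ → ℕ}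
    (hk : Tendsto (fun n : ℕ => (k n : ℝ) / n) atTop (𝓝 0)) : ∀ᶠ n in atTop, k n ≤ n := by
  filter_upwards [hk.eventually_lt_const one_pos, eventually_ge_atTop 1] with n hn h1
  rw [div_lt_one (by exact_mod_cast h1)] at hn
  exact_mod_cast hn.le

theorem limsup_distAt_le {k : ℕ → ℕ} (hsq : Tendsto (fun n : ℕ => (k n : ℝ) ^ 2 / n) atTop (𝓝 0))
    (htop : Tendsto k atTop atTop) (α : ℝ) :
    limsup (fun n : ℕ => distAt randomToRandom n (k n) ((1 / 2) * n * Real.log (k n) + α * n))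
      atTop ≤ 2 * Real.exp 2 * Real.exp (-2 * α) := by
  have hlim : Tendsto (fun n : ℕ => 2 * Real.exp 2 * Real.exp (-2 * α) + 2 * ((k n : ℝ) ^ 2 / n))
      atTop (𝓝 (2 * Real.exp 2 * Real.exp (-2 * α))) := by
    simpa using (hsq.const_mul 2).const_add (2 * Real.exp 2 * Real.exp (-2 * α))
  rw [← hlim.limsup_eq]
  refine limsup_le_limsup ?_ (isBoundedUnder_ge_distAt _ _ _).isCoboundedUnder_le
    hlim.isBoundedUnder_le
  filter_upwards [eventually_ge_atTop 2, htop.eventually_ge_atTop 1] with n hn hk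
  have hn0 : (n : ℝ) ≠ 0 := by positivity
  have hk0 : (0 : ℝ) < k n := by exact_mod_cast hk
  refine (distAt_le hn _ _).trans (le_of_eq ?_)
  have e : -2 * ((1 / 2) * n * Real.log (k n) + α * n) / n = -2 * α - Real.log (k n) := by
    field_simp
    ring
  rw [e, Real.exp_sub, Real.exp_log hk0]
  field_simp

theorem le_liminf_distAt {k : ℕ → ℕ} (hdiv : Tendsto (fun n : ℕ => (k n : ℝ) / n) atTop (𝓝 0))
    (htop : Tendsto k atTop atTop) {α : ℝ} (hα : α ≤ 0) :
    1 - Real.exp (2 * α + 1) ≤ liminf (fun n : ℕ =>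
      distAt randomToRandom n (k n) ((1 / 2) * n * Real.log (k n) + α * n)) atTop := by
  have hlim : Tendsto (fun n : ℕ => 1 - Real.exp (2 * α + 1) - (k n : ℝ) / n)
      atTop (𝓝 (1 - Real.exp (2 * α + 1))) := by
    simpa using hdiv.const_sub (1 - Real.exp (2 * α + 1))
  rw [← hlim.liminf_eq]
  refine liminf_le_liminf ?_ hlim.isBoundedUnder_ge
    (isBoundedUnder_le_distAt _ _ _).isCoboundedUnder_ge
  have hlog : Tendsto (fun n => Real.log (k n)) atTop atTop :=
    Real.tendsto_log_atTop.comp (tendsto_natCast_atTop_atTop.comp htop)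
  filter_upwards [eventually_ge_atTop 2, htop.eventually_ge_atTop 1,
    eventually_le_of_tendsto_div hdiv, hlog.eventually_ge_atTop (-2 * α)] with n hn hk hkn hL
  have : NeZero n := ⟨by omega⟩
  have hn' : (2 : ℝ) ≤ n := by exact_mod_cast hn
  have hk0 : (0 : ℝ) < k n := by exact_mod_cast hk
  have hkn' : (k n : ℝ) ≤ n := by exact_mod_cast hkn
  have h1 : (0 : ℝ) < n - 1 := by linarith
  set s : ℝ := (1 / 2) * n * Real.log (k n) + α * n with hs
  have hs0 : 0 ≤ s := by
    have : s = (1 / 2) * n * (Real.log (k n) + 2 * α) := by rw [hs]; ring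
    rw [this]
    have : 0 ≤ Real.log (k n) + 2 * α := by linarith
    positivity
  have hpow := exp_neg_le_pow_floor hn le_rfl hs0
  -- Replacing `n` by `n - 1` costs at most `log k / (n - 1) ≤ 1`, because `α ≤ 0` and `log k ≤ k -
  -- 1 ≤ n - 1`.
  have hexp : 2 * s / (n - 1) ≤ Real.log (k n) + 2 * α + 1 := by
    rw [div_le_iff₀ h1, hs]
    nlinarith [Real.log_le_sub_one_of_pos hk0]
  have hbound : Real.exp (-2 * α - 1) ≤ k n * (1 - 1 / n : ℝ) ^ (2 * ⌊s⌋₊) := by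
    calc Real.exp (-2 * α - 1) = k n * Real.exp (-(Real.log (k n) + 2 * α + 1)) := by
          nth_rewrite 1 [← Real.exp_log hk0]
          rw [← Real.exp_add]
          congr 1
          ring
      _ ≤ k n * Real.exp (-(2 * s / (n - 1))) := by gcongr
      _ ≤ _ := by gcongr
  rw [distAt_of_ne_zero]
  refine le_trans ?_ (one_sub_le_partialDist hn hk hkn _)
  have hinv := one_div_le_one_div_of_le (Real.exp_pos _) hbound
  have e : 1 / Real.exp (-2 * α - 1) = Real.exp (2 * α + 1) := by
    rw [one_div, ← Real.exp_neg]
    congr 1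
    ring
  rw [e] at hinv
  linarith

theorem hasPartialCutoff_randomToRandom {k : ℕ → ℕ}
    (hsq : Tendsto (fun n : ℕ => (k n : ℝ) ^ 2 / n) atTop (𝓝 0)) (htop : Tendsto k atTop atTop) :
    HasPartialCutoff randomToRandom k (fun n : ℕ => (1 / 2) * n * Real.log (k n))
      fun n : ℕ => (n : ℝ) where
  window := by
    have hlog : Tendsto (fun n => Real.log (k n)) atTop atTop :=
      Real.tendsto_log_atTop.comp (tendsto_natCast_atTop_atTop.comp htop)
    rw [isLittleO_iff]
    intro c hc
    filter_upwards [hlog.eventually_ge_atTop (2 / c)] with n hn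
    have hL : 0 ≤ Real.log (k n) := (by positivity : 0 ≤ 2 / c).trans hn
    rw [Real.norm_of_nonneg (Nat.cast_nonneg n), Real.norm_of_nonneg (by positivity)]
    rw [div_le_iff₀ hc] at hn
    nlinarith [Nat.cast_nonneg (α := ℝ) n]
  after := by
    refine tendsto_of_tendsto_of_tendsto_of_le_of_le tendsto_const_nhds (h :=
      fun α => 2 * Real.exp 2 * Real.exp (-2 * α)) ?_ (fun α => ?_) fun α =>
      limsup_distAt_le hsq htop α
    · have : Tendsto (fun α : ℝ => -2 * α) atTop atBot :=
        tendsto_id.const_mul_atTop_of_neg (by norm_num)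
      simpa using (Real.tendsto_exp_atBot.comp this).const_mul (2 * Real.exp 2)
    · exact le_limsup_of_frequently_le
        (Eventually.of_forall fun n => distAt_nonneg _ _ _ _).frequently
        (isBoundedUnder_le_distAt _ _ _)
  before := by
    refine tendsto_of_tendsto_of_tendsto_of_le_of_le' (g := fun α => 1 - Real.exp (2 * α + 1))
      ?_ tendsto_const_nhds ?_ (Eventually.of_forall fun α => ?_)
    · have h1 : Tendsto (fun α : ℝ => 2 * α + 1) atBot atBot :=
        tendsto_atBot_add_const_right _ _ (tendsto_id.const_mul_atBot two_pos)
      simpa using (Real.tendsto_exp_atBot.comp h1).const_sub 1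
    · filter_upwards [eventually_le_atBot 0] with α hα
      exact le_liminf_distAt (tendsto_div_of_sq_div hsq) htop hα
    · exact liminf_le_of_frequently_le
        (Eventually.of_forall fun n => distAt_le_one _ _ _ _).frequently
        (isBoundedUnder_ge_distAt _ _ _)

/-! ### No cutoff for bounded `k`, and the single-card bound. -/

theorem partialDist_zero {n : ℕ} [NeZero n] (hn : 2 ≤ n) (t : ℕ) :
    partialDist (randomToRandom n) 0 t = 0 :=
  le_antisymm (by simpa using partialDist_le hn 0 t) (partialDist_nonneg _ _ _)

/-- Before time `T * n` one card is still untouched with probability at least `exp (-4T)`, as `n /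
(n - 1) ≤ 2`; the uniform correction `K / n` is eventually below half of that. -/
theorem eventually_le_of_partialCutoff {k : ℕ → ℕ} {K : ℕ} (hK : ∀ n, k n < K)
    (hpos : ∀ᶠ n in atTop, 0 < k n) {s : ℕ → ℝ} {T : ℝ} (hT : 0 ≤ T)
    (hs : ∀ᶠ n in atTop, distAt randomToRandom n (k n) (s n) < Real.exp (-(4 * T)) / 2) :
    ∀ᶠ n in atTop, T * n ≤ s n := by
  have hKn : Tendsto (fun n : ℕ => (K : ℝ) / n) atTop (𝓝 0) :=
    tendsto_const_div_atTop_nhds_zero_nat _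
  filter_upwards [eventually_ge_atTop 2, eventually_ge_atTop K, hpos, hs,
    hKn.eventually_lt_const (half_pos (Real.exp_pos (-(4 * T))))] with n hn hnK hk hsn hsmall
  by_contra! hlt
  have : NeZero n := ⟨by omega⟩
  have hn' : (2 : ℝ) ≤ n := by exact_mod_cast hn
  have h1 := exp_neg_le_pow_floor hn hlt.le (by positivity)
  have h2 := pow_sub_le_partialDist hk ((hK n).le.trans hnK) ⌊s n⌋₊
  rw [distAt_of_ne_zero] at hsn
  have h3 : Real.exp (-(4 * T)) ≤ Real.exp (-(2 * (T * n) / (n - 1))) := by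
    rw [Real.exp_le_exp, neg_le_neg_iff, div_le_iff₀ (by linarith)]
    nlinarith
  have h4 : (k n : ℝ) / n ≤ K / n := by
    gcongr
    exact (hK n).le
  linarith

theorem not_hasPartialCutoff_randomToRandom {k : ℕ → ℕ} {K : ℕ} (hK : ∀ n, k n < K)
    {tmix ω : ℕ → ℝ} : ¬ HasPartialCutoff randomToRandom k tmix ω := by
  rintro ⟨hwin, hafter, hbefore⟩
  have hbefore' := hbefore.eventually_const_lt (show (1 / 2 : ℝ) < 1 by norm_num)
  obtain ⟨β, hβ⟩ := hbefore'.exists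
  have hβ := eventually_lt_of_lt_liminf hβ (isBoundedUnder_ge_distAt _ _ _)
  -- With no cards the distance is zero, contradicting its exceeding `1/2`.
  have hpos : ∀ᶠ n in atTop, 0 < k n := by
    filter_upwards [hβ, eventually_ge_atTop 2] with n h hn
    have : NeZero n := ⟨by omega⟩
    by_contra hk
    rw [Nat.eq_zero_of_not_pos hk, distAt_of_ne_zero, partialDist_zero hn] at h
    norm_num at h
  -- The rate `2/3` comes from evaluating `exp (-2s/n)` at `s = (T/3) n`.
  have hE : Tendsto (fun T : ℝ => 2 * K * (Real.exp 2 * Real.exp (-(2 / 3) * T))) atTop (𝓝 0) := by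
    have h1 : Tendsto (fun T : ℝ => -(2 / 3) * T) atTop atBot :=
      tendsto_id.const_mul_atTop_of_neg (by norm_num)
    simpa using ((Real.tendsto_exp_atBot.comp h1).const_mul (Real.exp 2)).const_mul (2 * (K : ℝ))
  obtain ⟨T, hT, hT0⟩ :=
    ((hE.eventually_lt_const (show (0 : ℝ) < 1 / 4 by norm_num)).and (eventually_ge_atTop 1)).exists
  obtain ⟨α, hα⟩ := (hafter.eventually_lt_const (half_pos (Real.exp_pos (-(4 * T))))).exists
  have hα := eventually_le_of_partialCutoff hK hpos (by linarith)
    (eventually_lt_of_limsup_lt hα (isBoundedUnder_le_distAt _ _ _))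
  have hsmall : ∀ γ : ℝ, ∀ᶠ n in atTop, |γ * ω n| ≤ 1 / 2 * |tmix n| := fun γ => by
    simpa using (hwin.const_mul_left γ).bound (show (0 : ℝ) < 1 / 2 by norm_num)
  have hKn : Tendsto (fun n : ℕ => 2 * (K : ℝ) ^ 2 / n) atTop (𝓝 0) :=
    tendsto_const_div_atTop_nhds_zero_nat _
  obtain ⟨n, hn, hnβ, hnα, hωα, hωβ, hKn⟩ := ((eventually_ge_atTop 2).and (hβ.and (hα.and
    ((hsmall α).and ((hsmall β).and
      (hKn.eventually_lt_const (show (0 : ℝ) < 1 / 4 by norm_num))))))).exists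
  have hn' : (2 : ℝ) ≤ n := by exact_mod_cast hn
  have hTn : 0 < T * n := by positivity
  -- The sign of `tmix` is not given; were it nonpositive, `tmix + αω` would be too, yet it is at
  -- least `T * n`.
  have htpos : 0 < tmix n := by
    by_contra! h
    rw [abs_of_nonpos h] at hωα
    linarith [(abs_le.1 hωα).2]
  rw [abs_of_pos htpos] at hωα hωβ
  -- The window terms are at most half of `tmix`, so `tmix ≥ (2/3) T n`, and moving by `βω` keeps at
  -- least half of it.
  have hs : T / 3 * n ≤ tmix n + β * ω n := by
    linarith [(abs_le.1 hωα).2, (abs_le.1 hωβ).1]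
  have hle := distAt_le hn (k n) (tmix n + β * ω n)
  have hexp : Real.exp (-2 * (tmix n + β * ω n) / n) ≤ Real.exp (-(2 / 3) * T) := by
    rw [Real.exp_le_exp, div_le_iff₀ (by linarith)]
    linarith
  have hkK : (k n : ℝ) ≤ K := by exact_mod_cast (hK n).le
  have hfin : 2 * k n * (Real.exp 2 * Real.exp (-2 * (tmix n + β * ω n) / n) + k n / n)
      ≤ 2 * K * (Real.exp 2 * Real.exp (-(2 / 3) * T) + K / n) := by gcongr
  have e : 2 * K * (Real.exp 2 * Real.exp (-(2 / 3) * T) + K / n)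
      = 2 * K * (Real.exp 2 * Real.exp (-(2 / 3) * T)) + 2 * (K : ℝ) ^ 2 / n := by ring
  linarith

theorem cardDist_singleton_le_exp {n : ℕ} [NeZero n] (i : Fin n) (t : ℕ) :
    cardDist (randomToRandom n) {i} t ≤ Real.exp (-2 * t * (1 - 2 / n) / n) := by
  rcases Nat.lt_or_ge n 2 with h | hn
  -- Here `1 - 2/n = -1`, so the right side is at least 1.
  · obtain rfl : n = 1 := by have := NeZero.pos n; omega
    refine (cardDist_le_one _ _ _).trans (Real.one_le_exp ?_)
    have : (0 : ℝ) ≤ t := Nat.cast_nonneg t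
    norm_num
  · have h2 : (0 : ℝ) ≤ 2 / n := by positivity
    refine ((cardDist_singleton_le hn i t).trans (pow_le_exp_neg hn t)).trans ?_
    rw [Real.exp_le_exp]
    refine div_le_div_of_nonneg_right ?_ (Nat.cast_nonneg n)
    nlinarith [mul_nonneg (Nat.cast_nonneg (α := ℝ) t) h2]

end CardShuffle

end

theorem theorem4 :
    (∀ k : ℕ → ℕ,
      (fun n : ℕ => (k n : ℝ)) =o[atTop] (fun n : ℕ => ((n : ℝ) / Real.log n) ^ (1 / 2 : ℝ)) →
      Tendsto k atTop atTop →
      CardShuffle.HasPartialCutoff CardShuffle.randomToRandom k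
        (fun n : ℕ => (1 / 2) * n * Real.log (k n)) (fun n : ℕ => (n : ℝ))) ∧
    (∀ (k : ℕ → ℕ) (K : ℕ), (∀ n, k n < K) →
      ¬ ∃ tmix ω : ℕ → ℝ,
        CardShuffle.HasPartialCutoff CardShuffle.randomToRandom k tmix ω) ∧
    (∀ (n : ℕ) [NeZero n] (i : Fin n) (t : ℕ),
      CardShuffle.cardDist (CardShuffle.randomToRandom n) {i} t ≤
        Real.exp (-2 * t * (1 - 2 / n) / n)) := by
  exact ⟨fun k hk htop =>
      CardShuffle.hasPartialCutoff_randomToRandom (CardShuffle.tendsto_sq_div hk) htop,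
    fun k K hK ⟨_, _, h⟩ => CardShuffle.not_hasPartialCutoff_randomToRandom hK h,
    fun n _ i t => CardShuffle.cardDist_singleton_le_exp i t⟩
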